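/- Consider a buffer of $B$ bytes served in slotted time by a single processor. Finitely many packets arrive, each with an integer size in $\{1,\dots,L\}$ (bytes, $L\ge 1$) and an integer required number of processing cycles in $\{1,\dots,k\}$. Each slot has three phases: first, the stored packets with no residual cycles are transmitted; then new packets arrive one after the other, and arriving or stored packets may be dropped, the stored packets never exceeding $B$ bytes in total; then one processing cycle is given to at most one stored packet. The push-out policy $PO$ with SRPT (shortest remaining processing time) priorities keeps its buffer ordered by non-decreasing number of residual cycles (ties broken arbitrarily) and always processes the first packet. Whenever a packet arrives, $PO$ accepts it and then, as long as the last packet of the ordered buffer starts above byte position $B-2L+1$ (positions being numbered from $1$), drops that last packet. Let $OPT$ be the largest total number of bytes that any, possibly offline and clairvoyant, schedule with the same buffer can transmit on the same arrivals. Assume $B\ge 2L$ and put $$N=\left\lceil\frac{B-2L+1}{2L-1}\right\rceil .$$ Then for every arrival sequence and every execution of $PO$ on it, $$OPT\;\le\;\frac{(2L-1)(N+1)}{N\,L_a}\cdot ALG ,$$ where $ALG$ is the total number of bytes transmitted by $PO$ and $L_a$ is the average length of the packets transmitted by $PO$ (if no packet is transmitted by $PO$, the claim is that $OPT=0$). That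 is, $PO$ is at most $\frac{(2L-1)(N+1)}{N L_a}$-competitive for SRPT-based priorities. -/

import Mathlib

open scoped ENNReal

/-- A packet, recorded by its size in bytes and its current number of residual processing
cycles. An arriving packet carries its required number of cycles. -/
structure Packet where
  size : ℕ
  cycles : ℕ
deriving DecidableEq

/-- Arrivals, slot by slot (and in the order of arrival within a slot): finitely many packets,
of sizes in `{1, …, L}` and with required numbers of cycles in `{1, …, k}`. -/
structure IsArrivalSequence (L k : ℕ) (σ : ℕ → List Packet) : Prop where
  size_mem : ∀ t, ∀ p ∈ σ t, 1 ≤ p.size ∧ p.size ≤ L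
  cycles_mem : ∀ t, ∀ p ∈ σ t, 1 ≤ p.cycles ∧ p.cycles ≤ k
  finite : ∃ T, ∀ t, T ≤ t → σ t = []

/-- Overall length, in bytes, of a collection of packets. -/
def bytes (s : Multiset Packet) : ℕ := (s.map Packet.size).sum

/-- The packets that leave in the transmission phase. -/
def done (s : Multiset Packet) : Multiset Packet := s.filter (fun p => p.cycles = 0)

/-- The packets that stay after the transmission phase. -/
def pending (s : Multiset Packet) : Multiset Packet := s.filter (fun p => p.cycles ≠ 0)

/-- One processing cycle spent on a packet. -/
def Packet.work (p : Packet) : Packet := { p with cycles := p.cycles - 1 }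

/-- An arbitrary, possibly clairvoyant, way of serving the arrivals `σ` with a buffer of `B`
bytes and one processor. Slot `t` begins with buffer content `start t`; the packets with no
residual cycles are transmitted; then the arrivals of the slot come in, and any of the packets at
hand, arriving or stored, may be dropped, which leaves `mid t`; then at most one stored packet
receives a processing cycle. -/
structure Schedule (B : ℕ) (σ : ℕ → List Packet) where
  start : ℕ → Multiset Packet
  mid : ℕ → Multiset Packet
  start_zero : start 0 = 0
  admission : ∀ t, mid t ≤ pending (start t) + (σ t : Multiset Packet)
  capacity : ∀ t, bytes (mid t) ≤ B
  processing : ∀ t, start (t + 1) = mid t ∨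
    ∃ p ∈ mid t, start (t + 1) = p.work ::ₘ (mid t).erase p

/-- Overall number of bytes transmitted by a schedule. -/
noncomputable def Schedule.throughput {B : ℕ} {σ : ℕ → List Packet} (O : Schedule B σ) : ℝ≥0∞ :=
  ∑' t, (bytes (done (O.start t)) : ℝ≥0∞)

/-- Throughput of an optimal offline solution. -/
noncomputable def optThroughput (B : ℕ) (σ : ℕ → List Packet) : ℝ≥0∞ :=
  ⨆ O : Schedule B σ, O.throughput

/-- The loop "while the last packet starts above position `B - 2L + 1`, drop it". Byte positions
in the buffer are numbered from `1`, so the last packet of `buf` starts at position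
`bytes buf.dropLast + 1`; the inequality is written without subtraction. -/
def pushOut (B L : ℕ) (buf : List Packet) : List Packet :=
  if buf ≠ [] ∧ B + 1 < (bytes (buf.dropLast : Multiset Packet) + 1) + 2 * L then
    pushOut B L buf.dropLast
  else buf
termination_by buf.length
decreasing_by
  rename_i h
  have := List.length_pos_iff.mpr h.1
  simp only [List.length_dropLast]
  omega

/-- `POArrivals B L buf ps buf'`: when the packets `ps` arrive one after the other at the
preemptive policy with SRPT priorities, its buffer can go from `buf` to `buf'`. Each arriving
packet is first accepted, which gives a buffer `q` ordered by residual cycles (ties in any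
order), and then packets are pushed out from the end. -/
inductive POArrivals (B L : ℕ) : List Packet → List Packet → List Packet → Prop
  | nil (buf : List Packet) : POArrivals B L buf [] buf
  | cons (buf : List Packet) (p : Packet) (ps q buf' : List Packet)
      (perm : q.Perm (p :: buf))
      (sorted : q.Pairwise (fun x y => x.cycles ≤ y.cycles))
      (rest : POArrivals B L (pushOut B L q) ps buf') : POArrivals B L buf (p :: ps) buf'

/-- The processing phase under a priority discipline: the head-of-line packet is processed. -/
def workHead : List Packet → List Packet
  | [] => []
  | p :: buf => p.work :: buf

/-- An execution of the preemptive policy PO with SRPT priorities on the arrivals `σ`; the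
phases are those of `Schedule`, and the buffers are listed from the head of line on. -/
structure PORun (B L : ℕ) (σ : ℕ → List Packet) where
  start : ℕ → List Packet
  mid : ℕ → List Packet
  start_zero : start 0 = []
  admission : ∀ t, POArrivals B L ((start t).filter (fun p => p.cycles ≠ 0)) (σ t) (mid t)
  processing : ∀ t, start (t + 1) = workHead (mid t)

/-- Overall number of bytes transmitted by PO. -/
noncomputable def PORun.throughput {B L : ℕ} {σ : ℕ → List Packet} (P : PORun B L σ) : ℝ≥0∞ :=
  ∑' t, (bytes (done (P.start t : Multiset Packet)) : ℝ≥0∞)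

/-- Overall number of packets transmitted by PO. -/
noncomputable def PORun.count {B L : ℕ} {σ : ℕ → List Packet} (P : PORun B L σ) : ℝ≥0∞ :=
  ∑' t, ((done (P.start t : Multiset Packet)).card : ℝ≥0∞)

/-- Average length `L_a` of the packets transmitted by PO. -/
noncomputable def PORun.avgLength {B L : ℕ} {σ : ℕ → List Packet} (P : PORun B L σ) : ℝ≥0∞ :=
  P.throughput / P.count

/-- `N = ⌈(B - 2L + 1) / (2L - 1)⌉`. -/
noncomputable def spread (B L : ℕ) : ℕ := ⌈((B : ℝ) - 2 * L + 1) / (2 * L - 1)⌉₊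

/-!
The quantity `PO.throughput / L_a` is the number of packets that PO transmits, so the claim is
that `N` times the bytes of any schedule are at most `D = (2L - 1)(N + 1)` times the packets of PO.

Suppose the schedule has transmitted `o` bytes and stores `X`, and PO has transmitted `a` packets
and stores `buf`. The invariant (`Dominates`) says that PO can always keep up: for every `S ≤ X`
there is a `T ≤ buf` which needs no more processing than `S`, and such that
`N * (o + bytes S) ≤ D * (a + |T|)`.

* Processing: a collection `S` loses at most one cycle. PO works on a packet with fewest residual
  cycles, and such a packet may be exchanged into any nonempty `T` (`exists_exchange_head`), so `T`
  loses a cycle as well.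
* Transmission: packets without residual cycles are moved from `X`, `buf` to `o`, `a`.
* Arrival of a packet: it adds at most `L` bytes to `S` and one packet to `T`, and `N * L ≤ D`.
* Push-out: the packets that remain are the first ones of the ordered buffer, so that `T` may be
  replaced by an initial segment of the same cardinality if that is still present. If it is not,
  replace `T` by all that remains. After a push-out PO stores at least `B - 2L + 1` bytes, hence at
  least `N` packets, while `bytes S ≤ B ≤ D`; together with `N * o ≤ D * a`, the invariant for
  `S = 0`, this suffices.
-/

/-! ### Residual work of collections of packets -/

/-- Overall number of residual cycles of a collection of packets. -/
def residualWork (s : Multiset Packet) : ℕ := (s.map Packet.cycles).sum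

@[simp] lemma bytes_zero : bytes 0 = 0 := rfl

@[simp] lemma bytes_cons (p : Packet) (s : Multiset Packet) :
    bytes (p ::ₘ s) = p.size + bytes s := by simp [bytes]

@[simp] lemma bytes_add (s u : Multiset Packet) : bytes (s + u) = bytes s + bytes u := by
  simp [bytes]

lemma bytes_mono {s u : Multiset Packet} (h : s ≤ u) : bytes s ≤ bytes u := by
  obtain ⟨v, rfl⟩ := Multiset.le_iff_exists_add.mp h
  simp

lemma card_le_bytes {s : Multiset Packet} (h : ∀ p ∈ s, 1 ≤ p.size) : s.card ≤ bytes s := by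
  induction s using Multiset.induction with
  | empty => simp
  | cons p s ih =>
    have h1 := h p (by simp)
    have h2 := ih fun q hq => h q (by simp [hq])
    simp only [Multiset.card_cons, bytes_cons]
    omega

lemma bytes_le_mul_card {L : ℕ} {s : Multiset Packet} (h : ∀ p ∈ s, p.size ≤ L) :
    bytes s ≤ L * s.card := by
  induction s using Multiset.induction with
  | empty => simp
  | cons p s ih =>
    have h1 := h p (by simp)
    have h2 := ih fun q hq => h q (by simp [hq])
    simp only [Multiset.card_cons, bytes_cons, mul_add]
    omega

@[simp] lemma residualWork_zero : residualWork 0 = 0 := rfl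

@[simp] lemma residualWork_cons (p : Packet) (s : Multiset Packet) :
    residualWork (p ::ₘ s) = p.cycles + residualWork s := by simp [residualWork]

@[simp] lemma residualWork_add (s u : Multiset Packet) :
    residualWork (s + u) = residualWork s + residualWork u := by
  simp [residualWork]

lemma residualWork_mono {s u : Multiset Packet} (h : s ≤ u) :
    residualWork s ≤ residualWork u := by
  obtain ⟨v, rfl⟩ := Multiset.le_iff_exists_add.mp h
  simp

lemma residualWork_done (s : Multiset Packet) : residualWork (done s) = 0 := by
  rw [residualWork, Multiset.sum_eq_zero_iff]
  intro x hx
  obtain ⟨p, hp, rfl⟩ := Multiset.mem_map.mp hx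
  exact (Multiset.mem_filter.mp hp).2

lemma done_add_pending (s : Multiset Packet) : done s + pending s = s :=
  Multiset.filter_add_not _ s

lemma card_le_residualWork {s : Multiset Packet} (h : ∀ p ∈ s, 1 ≤ p.cycles) :
    s.card ≤ residualWork s := by
  induction s using Multiset.induction with
  | empty => simp
  | cons p s ih =>
    have h1 := h p (by simp)
    have h2 := ih fun q hq => h q (by simp [hq])
    simp only [Multiset.card_cons, residualWork_cons]
    omega

/-! ### Ordered buffers and push-out -/

/-- The buffer is ordered by non-decreasing number of residual cycles. -/
def SortedByCycles (l : List Packet) : Prop := l.Pairwise (fun x y => x.cycles ≤ y.cycles)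

/-- A packet with fewest residual cycles can be exchanged into any nonempty collection without
increasing its work. -/
lemma exists_exchange_head {h : Packet} {l : List Packet} (hl : ∀ x ∈ l, h.cycles ≤ x.cycles)
    {T : Multiset Packet} (hT : T ≤ ((h :: l : List Packet) : Multiset Packet)) (h0 : T ≠ 0) :
    ∃ U ≤ (l : Multiset Packet), U.card + 1 = T.card ∧
      h.cycles + residualWork U ≤ residualWork T := by
  rw [← Multiset.cons_coe] at hT
  by_cases hm : h ∈ T
  · obtain ⟨U, rfl⟩ := Multiset.exists_cons_of_mem hm
    exact ⟨U, (Multiset.cons_le_cons_iff h).mp hT, by simp, by simp⟩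
  · have hT' : T ≤ (l : Multiset Packet) := (Multiset.le_cons_of_notMem hm).mp hT
    obtain ⟨x, hx⟩ := Multiset.exists_mem_of_ne_zero h0
    obtain ⟨U, rfl⟩ := Multiset.exists_cons_of_mem hx
    refine ⟨U, (Multiset.le_cons_self U x).trans hT', by simp, ?_⟩
    have := hl x (by simpa using Multiset.mem_of_le hT' hx)
    simpa using this

lemma SortedByCycles.residualWork_take_le {q : List Packet} (hq : SortedByCycles q)
    {T : Multiset Packet} (hT : T ≤ (q : Multiset Packet)) {m : ℕ} (hm : m ≤ T.card) :
    residualWork (q.take m : Multiset Packet) ≤ residualWork T := by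
  induction q generalizing T m with
  | nil => simp
  | cons h l ih =>
    obtain ⟨hh, hl⟩ := List.pairwise_cons.mp hq
    cases m with
    | zero => simp
    | succ m =>
      have h0 : T ≠ 0 := by
        rintro rfl
        simp at hm
      obtain ⟨U, hU, hc, hw⟩ := exists_exchange_head hh hT h0
      have := ih hl hU (m := m) (by omega)
      rw [List.take_succ_cons, ← Multiset.cons_coe, residualWork_cons]
      omega

lemma SortedByCycles.workHead {l : List Packet} (hl : SortedByCycles l) :
    SortedByCycles (workHead l) := by
  cases l with
  | nil => exact hl
  | cons h l =>
    obtain ⟨hh, hl⟩ := List.pairwise_cons.mp hl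
    exact List.pairwise_cons.mpr ⟨fun x hx => (Nat.sub_le _ _).trans (hh x hx), hl⟩

lemma length_workHead (l : List Packet) : (workHead l).length = l.length := by
  cases l <;> rfl

lemma size_le_of_mem_workHead {L : ℕ} {l : List Packet} (h : ∀ x ∈ l, 1 ≤ x.size ∧ x.size ≤ L) :
    ∀ x ∈ workHead l, 1 ≤ x.size ∧ x.size ≤ L := by
  cases l with
  | nil => exact h
  | cons p l =>
    intro x hx
    rcases List.mem_cons.mp hx with rfl | hx
    · exact h p (by simp)
    · exact h x (by simp [hx])

lemma pushOut_prefix (B L : ℕ) (q : List Packet) : pushOut B L q <+: q := by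
  induction q using pushOut.induct B L with
  | case1 q h ih =>
    rw [pushOut, if_pos h]
    exact ih.trans (List.dropLast_prefix q)
  | case2 q h => rw [pushOut, if_neg h]

/-- If anything is pushed out, then at least `B - 2L + 1` bytes remain. -/
lemma pushOut_eq_or_lt_bytes (B L : ℕ) (q : List Packet) :
    pushOut B L q = q ∨ B < bytes (pushOut B L q : Multiset Packet) + 2 * L := by
  induction q using pushOut.induct B L with
  | case1 q h ih =>
    rw [pushOut, if_pos h]
    refine Or.inr (ih.elim (fun e => ?_) id)
    rw [e]
    omega
  | case2 q h =>
    left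
    rw [pushOut, if_neg h]

/-! ### The invariant -/

/-- The properties of PO's buffer between transmission and processing: it is ordered, no packet is
completed, and sizes are in `{1, …, L}`. -/
structure IsPOBuffer (L : ℕ) (l : List Packet) : Prop where
  sorted : SortedByCycles l
  cycles_pos : ∀ p ∈ l, 1 ≤ p.cycles
  size_mem : ∀ p ∈ l, 1 ≤ p.size ∧ p.size ≤ L

/-- PO, having transmitted `a` packets and storing `buf`, keeps up with a schedule that has
transmitted `o` bytes and stores `X`, at the rate of `D / N` bytes per packet: whatever part `S`
of its buffer the schedule may choose to complete, PO can complete some `T` with no more work so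
that the rate is respected. -/
def Dominates (N D a : ℕ) (buf : List Packet) (o : ℕ) (X : Multiset Packet) : Prop :=
  ∀ S ≤ X, ∃ T ≤ (buf : Multiset Packet), residualWork T ≤ residualWork S ∧
    N * (o + bytes S) ≤ D * (a + T.card)

section Invariant

variable {N D L B a o : ℕ} {buf : List Packet} {X : Multiset Packet}

lemma Dominates.mul_le (h : Dominates N D a buf o X) (hbuf : ∀ p ∈ buf, 1 ≤ p.cycles) :
    N * o ≤ D * a := by
  obtain ⟨T, hT, hw, hc⟩ := h 0 (Multiset.zero_le X)
  have hT0 : T.card = 0 := by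
    have := card_le_residualWork (s := T) fun p hp =>
      hbuf p (by simpa using Multiset.mem_of_le hT hp)
    rw [residualWork_zero] at hw
    omega
  simpa [hT0] using hc

lemma Dominates.mono_right (h : Dominates N D a buf o X) {Y : Multiset Packet} (hY : Y ≤ X) :
    Dominates N D a buf o Y := fun S hS => h S (hS.trans hY)

lemma Dominates.transmit (h : Dominates N D a buf o X) :
    Dominates N D (a + (done (buf : Multiset Packet)).card)
      (buf.filter (fun p => p.cycles ≠ 0)) (o + bytes (done X)) (pending X) := by
  intro S hS
  obtain ⟨T, hT, hw, hc⟩ := h (done X + S) (by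
    conv_rhs => rw [← done_add_pending X]
    gcongr)
  have hTcard : T.card = (done T).card + (pending T).card := by
    rw [← Multiset.card_add, done_add_pending]
  refine ⟨pending T, ?_, ?_, ?_⟩
  · simpa [pending] using Multiset.filter_le_filter (fun p => p.cycles ≠ 0) hT
  · rw [residualWork_add, residualWork_done, zero_add] at hw
    exact (residualWork_mono (Multiset.filter_le _ _)).trans hw
  · have hd : (done T).card ≤ (done (buf : Multiset Packet)).card :=
      Multiset.card_le_card (Multiset.filter_le_filter _ hT)
    rw [bytes_add, ← add_assoc] at hc
    refine hc.trans (Nat.mul_le_mul_left D ?_)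
    omega

lemma Dominates.process (h : Dominates N D a buf o X) (hbuf : IsPOBuffer L buf)
    (hX : ∀ p ∈ X, 1 ≤ p.cycles) {Y : Multiset Packet}
    (hY : Y = X ∨ ∃ p ∈ X, Y = p.work ::ₘ X.erase p) :
    Dominates N D a (workHead buf) o Y := by
  intro S hS
  -- The state of `S` before processing.
  obtain ⟨S', hS', hb, hw'⟩ :
      ∃ S' ≤ X, bytes S' = bytes S ∧ residualWork S' ≤ residualWork S + 1 := by
    rcases hY with rfl | ⟨p, hp, rfl⟩
    · exact ⟨S, hS, rfl, Nat.le_succ _⟩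
    by_cases hm : p.work ∈ S
    · obtain ⟨U, rfl⟩ := Multiset.exists_cons_of_mem hm
      have hU := (Multiset.cons_le_cons_iff _).mp hS
      refine ⟨p ::ₘ U, ?_, by simp [Packet.work], ?_⟩
      · rw [← Multiset.cons_erase hp]
        exact (Multiset.cons_le_cons_iff p).mpr hU
      · have := hX p hp
        simp only [residualWork_cons, Packet.work]
        omega
    · exact ⟨S, ((Multiset.le_cons_of_notMem hm).mp hS).trans (Multiset.erase_le p X), rfl,
        Nat.le_succ _⟩
  obtain ⟨T, hT, hw, hc⟩ := h S' hS'
  rw [hb] at hc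
  rcases eq_or_ne T 0 with rfl | h0
  · exact ⟨0, Multiset.zero_le _, by simp, hc⟩
  cases buf with
  | nil => exact absurd (by simpa using hT) h0
  | cons p l =>
    obtain ⟨U, hU, hcard, hwU⟩ :=
      exists_exchange_head (List.pairwise_cons.mp hbuf.sorted).1 hT h0
    have hp := hbuf.cycles_pos p (by simp)
    refine ⟨p.work ::ₘ U, ?_, ?_, ?_⟩
    · rw [workHead, ← Multiset.cons_coe]
      exact (Multiset.cons_le_cons_iff _).mpr hU
    · simp only [residualWork_cons, Packet.work]
      omega
    · rwa [Multiset.card_cons, hcard]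

lemma Dominates.accept (h : Dominates N D a buf o X) {p : Packet} (hp : N * p.size ≤ D)
    {q : List Packet} (hq : q.Perm (p :: buf)) : Dominates N D a q o (p ::ₘ X) := by
  have hq' : (q : Multiset Packet) = p ::ₘ (buf : Multiset Packet) := by
    rw [Multiset.cons_coe]
    exact Multiset.coe_eq_coe.mpr hq
  intro S hS
  rw [hq']
  by_cases hm : p ∈ S
  · obtain ⟨U, rfl⟩ := Multiset.exists_cons_of_mem hm
    obtain ⟨T, hT, hw, hc⟩ := h U ((Multiset.cons_le_cons_iff p).mp hS)
    refine ⟨p ::ₘ T, (Multiset.cons_le_cons_iff p).mpr hT, by simpa using hw, ?_⟩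
    rw [bytes_cons, Multiset.card_cons]
    linarith
  · obtain ⟨T, hT, hw, hc⟩ := h S ((Multiset.le_cons_of_notMem hm).mp hS)
    exact ⟨T, hT.trans (Multiset.le_cons_self _ p), hw, hc⟩

/-- The buffer may be cut down to its first packets, as long as at least `N` of them remain. -/
lemma Dominates.of_prefix {q : List Packet} (h : Dominates N D a q o X)
    (hq : SortedByCycles q) (hpos : ∀ p ∈ q, 1 ≤ p.cycles) (hD : bytes X ≤ D)
    {l : List Packet} (hl : l <+: q) (hN : N ≤ l.length) : Dominates N D a l o X := by
  intro S hS
  obtain ⟨T, hT, hw, hc⟩ := h S hS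
  have htake : l.take (min T.card l.length) = q.take (min T.card l.length) := by
    obtain ⟨r, rfl⟩ := hl
    rw [List.take_append_of_le_length (min_le_right _ _)]
  refine ⟨(l.take (min T.card l.length) : Multiset Packet), ?_, ?_, ?_⟩
  · exact Multiset.coe_le.mpr (List.take_sublist _ _).subperm
  · rw [htake]
    exact (hq.residualWork_take_le hT (min_le_left _ _)).trans hw
  · rw [Multiset.coe_card, List.length_take, min_assoc, min_self]
    rcases le_total T.card l.length with hle | hle
    · rwa [min_eq_left hle]
    · rw [min_eq_right hle, mul_add, mul_add]
      have h1 := h.mul_le hpos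
      have h2 : N * bytes S ≤ D * l.length := by
        rw [mul_comm D]
        exact Nat.mul_le_mul hN ((bytes_mono hS).trans hD)
      omega

lemma POArrivals.isPOBuffer {ps buf' : List Packet} (h : POArrivals B L buf ps buf')
    (hbuf : IsPOBuffer L buf) (hps : ∀ p ∈ ps, (1 ≤ p.size ∧ p.size ≤ L) ∧ 1 ≤ p.cycles) :
    IsPOBuffer L buf' := by
  induction h with
  | nil => exact hbuf
  | cons buf p ps q buf' perm sorted rest ih =>
    have hp := hps p (by simp)
    have hsub := (pushOut_prefix B L q).sublist
    refine ih ⟨List.Pairwise.sublist hsub sorted, fun x hx => ?_, fun x hx => ?_⟩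
      fun x hx => hps x (by simp [hx])
    all_goals
      rcases List.mem_cons.mp (perm.mem_iff.mp (hsub.subset hx)) with rfl | hx
    exacts [hp.2, hbuf.cycles_pos x hx, hp.1, hbuf.size_mem x hx]

/-- The hypothesis `hN` says that a buffer with at least `B - 2L + 1` bytes has at least `N`
packets. -/
lemma Dominates.arrivals {ps buf' : List Packet} (harr : POArrivals B L buf ps buf')
    (h : Dominates N D a buf o X) (hbuf : IsPOBuffer L buf)
    (hps : ∀ p ∈ ps, (1 ≤ p.size ∧ p.size ≤ L) ∧ 1 ≤ p.cycles)
    (hBD : B ≤ D) (hLD : N * L ≤ D) (hN : ∀ n, B < L * n + 2 * L → N ≤ n)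
    {M : Multiset Packet} (hM : M ≤ X + (ps : Multiset Packet)) (hMB : bytes M ≤ B) :
    Dominates N D a buf' o M := by
  induction harr generalizing X with
  | nil => exact h.mono_right (by simpa using hM)
  | cons buf p ps q buf' perm sorted rest ih =>
    have hp := hps p (by simp)
    have hps' : ∀ x ∈ ps, (1 ≤ x.size ∧ x.size ≤ L) ∧ 1 ≤ x.cycles :=
      fun x hx => hps x (by simp [hx])
    have hpos : ∀ x ∈ q, 1 ≤ x.cycles := fun x hx => by
      rcases List.mem_cons.mp (perm.mem_iff.mp hx) with rfl | hx
      exacts [hp.2, hbuf.cycles_pos x hx]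
    have hsub := (pushOut_prefix B L q).sublist
    have hbuf' : IsPOBuffer L (pushOut B L q) := by
      -- The buffer after the arrival of `p` alone.
      refine POArrivals.isPOBuffer (B := B) (.cons buf p [] q _ perm sorted (.nil _)) hbuf ?_
      simpa using hp
    -- The schedule drops only at the end of the phase, so that it may exceed `B` bytes before.
    -- Keep the packets that are needed for `M`, given the arrivals that are still to come.
    have hle : M - (ps : Multiset Packet) ≤ p ::ₘ X := by
      rw [Multiset.sub_le_iff_le_add]
      rwa [← Multiset.cons_coe, Multiset.add_cons, ← Multiset.cons_add] at hM
    have hB' : bytes (M - (ps : Multiset Packet)) ≤ B :=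
      (bytes_mono (Multiset.sub_le_self M _)).trans hMB
    have hacc : Dominates N D a q o (M - (ps : Multiset Packet)) :=
      (h.accept ((Nat.mul_le_mul_left N hp.1.2).trans hLD) perm).mono_right hle
    refine ih (X := M - (ps : Multiset Packet)) ?_ hbuf' hps' (Multiset.le_sub_add)
    rcases pushOut_eq_or_lt_bytes B L q with e | hlt
    · rwa [e]
    · refine hacc.of_prefix sorted hpos (hB'.trans hBD) (pushOut_prefix B L q) (hN _ ?_)
      have := bytes_le_mul_card (L := L) (s := (pushOut B L q : Multiset Packet))
        fun x hx => (hbuf'.size_mem x (by simpa using hx)).2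
      rw [Multiset.coe_card] at this
      omega

end Invariant

/-! ### Executions -/

section Executions

variable {B L k : ℕ} {σ : ℕ → List Packet}

lemma IsArrivalSequence.mem (hσ : IsArrivalSequence L k σ) (t : ℕ) :
    ∀ p ∈ σ t, (1 ≤ p.size ∧ p.size ≤ L) ∧ 1 ≤ p.cycles :=
  fun p hp => ⟨hσ.size_mem t p hp, (hσ.cycles_mem t p hp).1⟩

/-- PO's buffer at the beginning of a slot; it may contain completed packets. -/
lemma PORun.start_props (hσ : IsArrivalSequence L k σ) (P : PORun B L σ) (t : ℕ) :
    SortedByCycles (P.start t) ∧ ∀ p ∈ P.start t, 1 ≤ p.size ∧ p.size ≤ L := by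
  induction t with
  | zero => simp [P.start_zero, SortedByCycles]
  | succ t ih =>
    have hmid := (P.admission t).isPOBuffer
      ⟨List.Pairwise.filter _ ih.1,
        fun p hp => Nat.one_le_iff_ne_zero.mpr (by simpa using (List.mem_filter.mp hp).2),
        fun p hp => ih.2 p (List.mem_of_mem_filter hp)⟩ (hσ.mem t)
    rw [P.processing]
    exact ⟨hmid.sorted.workHead, size_le_of_mem_workHead hmid.size_mem⟩

lemma PORun.isPOBuffer_filter (hσ : IsArrivalSequence L k σ) (P : PORun B L σ) (t : ℕ) :
    IsPOBuffer L ((P.start t).filter (fun p => p.cycles ≠ 0)) :=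
  ⟨List.Pairwise.filter _ (P.start_props hσ t).1,
    fun p hp => Nat.one_le_iff_ne_zero.mpr (by simpa using (List.mem_filter.mp hp).2),
    fun p hp => (P.start_props hσ t).2 p (List.mem_of_mem_filter hp)⟩

/-- Number of packets that PO transmits before slot `t`. -/
def PORun.sent (P : PORun B L σ) (t : ℕ) : ℕ :=
  ∑ s ∈ Finset.range t, (done (P.start s : Multiset Packet)).card

/-- Number of bytes that a schedule transmits before slot `t`. -/
def Schedule.sentBytes (O : Schedule B σ) (t : ℕ) : ℕ :=
  ∑ s ∈ Finset.range t, bytes (done (O.start s))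

lemma Schedule.one_le_cycles_of_mem_mid (hσ : IsArrivalSequence L k σ) (O : Schedule B σ) (t : ℕ) :
    ∀ p ∈ O.mid t, 1 ≤ p.cycles := by
  intro p hp
  rcases Multiset.mem_add.mp (Multiset.mem_of_le (O.admission t) hp) with h | h
  · exact Nat.one_le_iff_ne_zero.mpr (Multiset.mem_filter.mp h).2
  · exact (hσ.mem t p (by simpa using h)).2

lemma dominates_start {N D : ℕ} (hσ : IsArrivalSequence L k σ) (P : PORun B L σ)
    (O : Schedule B σ) (hBD : B ≤ D) (hLD : N * L ≤ D)
    (hN : ∀ n, B < L * n + 2 * L → N ≤ n) (t : ℕ) :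
    Dominates N D (P.sent t) (P.start t) (O.sentBytes t) (O.start t) := by
  induction t with
  | zero =>
    intro S hS
    rw [O.start_zero, Multiset.le_zero] at hS
    exact ⟨0, Multiset.zero_le _, by simp [hS], by simp [hS, Schedule.sentBytes]⟩
  | succ t ih =>
    have hbuf := P.isPOBuffer_filter hσ t
    have hmid := ih.transmit.arrivals (P.admission t) hbuf (hσ.mem t) hBD hLD hN
      (O.admission t) (O.capacity t)
    have hnext := hmid.process ((P.admission t).isPOBuffer hbuf (hσ.mem t))
      (O.one_le_cycles_of_mem_mid hσ t) (O.processing t)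
    rw [P.processing, PORun.sent, Schedule.sentBytes, Finset.sum_range_succ,
      Finset.sum_range_succ]
    exact hnext

lemma mul_sentBytes_le {N D : ℕ} (hσ : IsArrivalSequence L k σ) (P : PORun B L σ)
    (O : Schedule B σ) (hBD : B ≤ D) (hLD : N * L ≤ D)
    (hN : ∀ n, B < L * n + 2 * L → N ≤ n) (t : ℕ) :
    N * O.sentBytes (t + 1) ≤ D * P.sent (t + 1) := by
  have h := (dominates_start hσ P O hBD hLD hN t).transmit.mul_le
    (P.isPOBuffer_filter hσ t).cycles_pos
  rw [PORun.sent, Schedule.sentBytes, Finset.sum_range_succ, Finset.sum_range_succ]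
  exact h

lemma mul_throughput_le {N D : ℕ} (hσ : IsArrivalSequence L k σ) (P : PORun B L σ)
    (O : Schedule B σ) (hBD : B ≤ D) (hLD : N * L ≤ D)
    (hN : ∀ n, B < L * n + 2 * L → N ≤ n) :
    (N : ℝ≥0∞) * O.throughput ≤ D * P.count := by
  rw [Schedule.throughput, ← ENNReal.tsum_mul_left]
  refine ENNReal.tsum_le_of_sum_range_le fun t => ?_
  calc ∑ s ∈ Finset.range t, (N : ℝ≥0∞) * (bytes (done (O.start s)) : ℝ≥0∞)
      ≤ ((N * O.sentBytes (t + 1) : ℕ) : ℝ≥0∞) := by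
        rw [← Finset.mul_sum, Schedule.sentBytes, Nat.cast_mul, Nat.cast_sum]
        gcongr
        exact Nat.le_succ t
    _ ≤ ((D * P.sent (t + 1) : ℕ) : ℝ≥0∞) := by
        exact_mod_cast mul_sentBytes_le hσ P O hBD hLD hN t
    _ ≤ D * P.count := by
        rw [PORun.sent, Nat.cast_mul, Nat.cast_sum, PORun.count]
        gcongr
        exact ENNReal.sum_le_tsum _

lemma optThroughput_mul_le {N D : ℕ} (hσ : IsArrivalSequence L k σ) (P : PORun B L σ)
    (hBD : B ≤ D) (hLD : N * L ≤ D) (hN : ∀ n, B < L * n + 2 * L → N ≤ n) :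
    (N : ℝ≥0∞) * optThroughput B σ ≤ D * P.count := by
  rw [optThroughput, ENNReal.mul_iSup]
  exact iSup_le fun O => mul_throughput_le hσ P O hBD hLD hN

/-! ### Finiteness of the average length -/

lemma POArrivals.length_le {buf ps buf' : List Packet} (h : POArrivals B L buf ps buf') :
    buf'.length ≤ buf.length + ps.length := by
  induction h with
  | nil => simp
  | cons buf p ps q buf' perm sorted rest ih =>
    have h1 := (pushOut_prefix B L q).length_le
    have h2 := perm.length_eq
    simp only [List.length_cons] at h2 ⊢
    omega

lemma PORun.sent_add_length_le (P : PORun B L σ) (t : ℕ) :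
    P.sent t + (P.start t).length ≤ ∑ s ∈ Finset.range t, (σ s).length := by
  induction t with
  | zero => simp [PORun.sent, P.start_zero]
  | succ t ih =>
    have h1 := (P.admission t).length_le
    have h2 : (P.start t).length = (done (P.start t : Multiset Packet)).card +
        ((P.start t).filter (fun p => p.cycles ≠ 0)).length := by
      conv_lhs => rw [← Multiset.coe_card, ← done_add_pending (P.start t : Multiset Packet)]
      simp [pending]
    have h3 : P.sent (t + 1) = P.sent t + (done (P.start t : Multiset Packet)).card :=
      Finset.sum_range_succ _ _
    rw [Finset.sum_range_succ, P.processing, length_workHead, h3]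
    omega

lemma PORun.count_ne_top (hσ : IsArrivalSequence L k σ) (P : PORun B L σ) : P.count ≠ ⊤ := by
  obtain ⟨T, hT⟩ := hσ.finite
  have hbound : ∀ t, P.sent t ≤ ∑ s ∈ Finset.range T, (σ s).length := by
    intro t
    refine (Nat.le_add_right _ _).trans ((P.sent_add_length_le t).trans ?_)
    refine Finset.sum_le_sum_of_ne_zero fun s _ hs => Finset.mem_range.mpr ?_
    by_contra! hTs
    exact hs (by simp [hT s hTs])
  refine ne_top_of_le_ne_top
    (ENNReal.natCast_ne_top (∑ s ∈ Finset.range T, (σ s).length)) ?_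
  refine ENNReal.tsum_le_of_sum_range_le fun t => ?_
  exact_mod_cast hbound t

lemma PORun.size_mem_of_mem_done (hσ : IsArrivalSequence L k σ) (P : PORun B L σ) (t : ℕ) :
    ∀ p ∈ done (P.start t : Multiset Packet), 1 ≤ p.size ∧ p.size ≤ L :=
  fun p hp => (P.start_props hσ t).2 p (by simpa using Multiset.mem_of_mem_filter hp)

lemma PORun.count_le_throughput (hσ : IsArrivalSequence L k σ) (P : PORun B L σ) :
    P.count ≤ P.throughput :=
  ENNReal.tsum_le_tsum fun t => by
    exact_mod_cast card_le_bytes fun p hp => (P.size_mem_of_mem_done hσ t p hp).1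

lemma PORun.throughput_ne_top (hσ : IsArrivalSequence L k σ) (P : PORun B L σ) :
    P.throughput ≠ ⊤ := by
  refine ne_top_of_le_ne_top (ENNReal.mul_ne_top (ENNReal.natCast_ne_top L) (P.count_ne_top hσ)) ?_
  rw [PORun.count, ← ENNReal.tsum_mul_left]
  exact ENNReal.tsum_le_tsum fun t => by
    exact_mod_cast bytes_le_mul_card fun p hp => (P.size_mem_of_mem_done hσ t p hp).2

end Executions

/-! ### The constant `N` -/

lemma spread_le_of_lt {B L n : ℕ} (hL : 1 ≤ L) (h : B < L * n + 2 * L) : spread B L ≤ n := by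
  have hL' : (1 : ℝ) ≤ L := by exact_mod_cast hL
  have h' : (B : ℝ) + 1 ≤ L * n + 2 * L := by exact_mod_cast h
  refine Nat.ceil_le.mpr ((div_le_iff₀ (by linarith)).mpr ?_)
  have : (0 : ℝ) ≤ n * (L - 1) := mul_nonneg n.cast_nonneg (by linarith)
  linarith

lemma spread_pos {B L : ℕ} (hL : 1 ≤ L) (hB : 2 * L ≤ B) : 0 < spread B L := by
  have hL' : (1 : ℝ) ≤ L := by exact_mod_cast hL
  have hB' : (2 : ℝ) * L ≤ B := by exact_mod_cast hB
  exact Nat.ceil_pos.mpr (div_pos (by linarith) (by linarith))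

lemma le_mul_spread_add_one {B L : ℕ} (hL : 1 ≤ L) : B ≤ (2 * L - 1) * (spread B L + 1) := by
  have hL' : (1 : ℝ) ≤ L := by exact_mod_cast hL
  have h : ((B : ℝ) - 2 * L + 1) / (2 * L - 1) ≤ spread B L := Nat.le_ceil _
  rw [div_le_iff₀ (by linarith)] at h
  have hcast : ((2 * L - 1 : ℕ) : ℝ) = 2 * L - 1 := by
    rw [Nat.cast_sub (by omega)]
    simp
  have : (B : ℝ) ≤ ((2 * L - 1 : ℕ) : ℝ) * (spread B L + 1) := by
    rw [hcast]
    linarith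
  exact_mod_cast this

theorem theorem5 (B L k : ℕ) (hL : 1 ≤ L) (hB : 2 * L ≤ B)
    (σ : ℕ → List Packet) (hσ : IsArrivalSequence L k σ) (P : PORun B L σ) :
    optThroughput B σ ≤
      ((2 * (L : ℝ≥0∞) - 1) * ((spread B L : ℝ≥0∞) + 1)) /
        ((spread B L : ℝ≥0∞) * P.avgLength) * P.throughput := by
  have hLD : spread B L * L ≤ (2 * L - 1) * (spread B L + 1) := by
    rw [mul_comm]
    exact Nat.mul_le_mul (by omega) (Nat.le_succ _)
  have hmain := optThroughput_mul_le hσ P (le_mul_spread_add_one hL) hLD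
    fun n hn => spread_le_of_lt hL hn
  have hD : (2 * (L : ℝ≥0∞) - 1) * ((spread B L : ℝ≥0∞) + 1) =
      (((2 * L - 1) * (spread B L + 1) : ℕ) : ℝ≥0∞) := by
    push_cast
    rfl
  rw [hD]
  have hN0 : (spread B L : ℝ≥0∞) ≠ 0 := by exact_mod_cast (spread_pos hL hB).ne'
  have hNtop : (spread B L : ℝ≥0∞) ≠ ⊤ := ENNReal.natCast_ne_top _
  generalize (((2 * L - 1) * (spread B L + 1) : ℕ) : ℝ≥0∞) = D at *
  rcases eq_or_ne P.count 0 with hc | hc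
  · -- PO transmits nothing, and the claim is that no schedule does.
    have h0 : optThroughput B σ = 0 := by simpa [hc, hN0] using hmain
    simp [h0]
  · have hctop := P.count_ne_top hσ
    have ht0 : P.throughput ≠ 0 := fun h =>
      hc (le_antisymm (h ▸ P.count_le_throughput hσ) zero_le)
    have httop := P.throughput_ne_top hσ
    have hcount : D / ((spread B L : ℝ≥0∞) * P.avgLength) * P.throughput =
        D * P.count / spread B L := by
      rw [PORun.avgLength, div_eq_mul_inv, div_eq_mul_inv,
        ENNReal.mul_inv (Or.inl hN0) (Or.inl hNtop),
        ENNReal.mul_inv (Or.inl ht0) (Or.inl httop), inv_inv, div_eq_mul_inv]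
      calc D * ((spread B L : ℝ≥0∞)⁻¹ * (P.throughput⁻¹ * P.count)) * P.throughput
          = D * P.count * (spread B L : ℝ≥0∞)⁻¹ * (P.throughput⁻¹ * P.throughput) := by ring
        _ = _ := by rw [ENNReal.inv_mul_cancel ht0 httop, mul_one]
    rw [hcount, ENNReal.le_div_iff_mul_le (Or.inl hN0) (Or.inl hNtop), mul_comm]
    exact hmain
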